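/- Let $p>3$ be a prime and let $\mathbb{Z}_p$ denote the ring of rational numbers whose denominator is not divisible by $p$. For $x,y\in\mathbb{Q}$ and $n\ge 1$, write $x\equiv y\pmod{p^n}$ if $x-y\in p^n\mathbb{Z}_p$. For $a\in\mathbb{Z}_p$ let $\langle a\rangle_p\in\{0,1,\ldots,p-1\}$ be given by $a\equiv\langle a\rangle_p\pmod p$, and let $\binom{a}{k}=\frac{a(a-1)\cdots(a-k+1)}{k!}$. The Euler numbers $E_n$ and Euler polynomials $E_n(x)$ are defined by $$E_0=1,\qquad E_n=-\sum_{k=1}^{\lfloor n/2\rfloor}\binom{n}{2k}E_{n-2k}\ (n\ge1),\qquad E_n(x)=\frac1{2^n}\sum_{r=0}^n\binom nr(2x-1)^{n-r}E_r\ (n\ge0).$$ **Theorem 4.4.** Let $p>3$ be a prime, $a\in\mathbb{Z}_p$ with $a\not\equiv0\pmod p$, and $t=(a-\langle a\rangle_p)/p$. Then, modulo $p^2$, $$\sum_{k=0}^{(p-1)/2}\frac{\binom ak\binom{-1-a}k}{2k-1}\equiv\begin{cases} 2pt-(2a+1)\displaystyle\sum_{k=0}^{p-1}\binom{2a}k(-2)^k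 & \text{if }\langle a\rangle_p<\frac p2,\\[2mm] 2p(t+1)-\dfrac{2a+1}{2t+1}-(2a+1)\Big(1+\dfrac1{2t+1}\Big)\displaystyle\sum_{k=0}^{p-1}\binom{2a}k(-2)^k & \text{if }\langle a\rangle_p>\frac p2\text{ and }t\not\equiv-\frac12\pmod p,\\[2mm] 2a+1+p\big(1+(2a+1)E_{p-2}(-2a)\big) & \text{if }\langle a\rangle_p>\frac p2\text{ and }t\equiv-\frac12\pmod p. \end{cases}$$ -/

import Mathlib

/-- `x` is a rational `p`-adic integer: a rational number whose denominator (in lowest terms)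
is not divisible by `p`. -/
def IsRatPadicInt (p : ℕ) (x : ℚ) : Prop := ¬ p ∣ x.den

/-- `x ≡ y (mod p ^ n)` for rational numbers: `x - y = p ^ n * z` for some rational `p`-adic
integer `z`. -/
def RatCongr (p n : ℕ) (x y : ℚ) : Prop :=
  ∃ z : ℚ, IsRatPadicInt p z ∧ x - y = (p : ℚ) ^ n * z

/-- The residue `⟨a⟩_p ∈ {0, 1, …, p - 1}` of a rational `p`-adic integer `a` modulo `p`:
the least natural number representing (numerator) * (denominator)⁻¹ modulo `p`. -/
noncomputable def ratResidue (p : ℕ) (a : ℚ) : ℕ :=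
  ((a.num : ZMod p) * (a.den : ZMod p)⁻¹).val

/-- For a prime `p` and a rational `p`-adic integer `a`, the number `ratResidue p a` is the unique
`r ∈ {0, 1, …, p - 1}` with `a ≡ r (mod p)`. -/
theorem ratResidue_spec {p : ℕ} (hp : p.Prime) {a : ℚ} (ha : IsRatPadicInt p a) (r : ℕ) :
    ratResidue p a = r ↔ r < p ∧ RatCongr p 1 a r := by
  have : Fact p.Prime := ⟨hp⟩
  have hd : (a.den : ZMod p) ≠ 0 := by
    rwa [Ne, ZMod.natCast_eq_zero_iff]
  have hdq : (a.den : ℚ) ≠ 0 := by exact_mod_cast a.den_nz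
  have haq : a = a.num / a.den := (Rat.num_div_den a).symm
  have hpq : (p : ℚ) ≠ 0 := by exact_mod_cast hp.ne_zero
  -- the congruence, read in `ZMod p`
  have key : ∀ s : ℕ, RatCongr p 1 a s ↔ (a.num : ZMod p) * (a.den : ZMod p)⁻¹ = s := by
    intro s
    rw [← div_eq_mul_inv, div_eq_iff hd]
    constructor
    · rintro ⟨z, hz, h⟩
      have hzq : (z.den : ℚ) ≠ 0 := by exact_mod_cast z.den_nz
      have hz' : (z.den : ZMod p) ≠ 0 := by
        rwa [Ne, ZMod.natCast_eq_zero_iff]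
      rw [pow_one, haq, ← Rat.num_div_den z] at h
      simp only [Rat.num_div_den] at h
      have h1 : ((a.num : ℚ) - s * a.den) * z.den = p * z.num * a.den := by
        have e1 := Rat.num_div_den a
        have e2 := Rat.num_div_den z
        rw [div_eq_iff hdq] at e1
        rw [div_eq_iff hzq] at e2
        rw [e1, e2]
        linear_combination (a.den : ℚ) * z.den * h
      have h2 : ((a.num : ℤ) - s * a.den) * z.den = p * z.num * a.den := by exact_mod_cast h1
      have h3 := congrArg (Int.cast : ℤ → ZMod p) h2
      push_cast at h3
      rw [ZMod.natCast_self, zero_mul, zero_mul] at h3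
      have h4 := (mul_eq_zero.mp h3).resolve_right hz'
      exact sub_eq_zero.mp h4
    · intro h
      have h1 : ((a.num - s * a.den : ℤ) : ZMod p) = 0 := by
        push_cast
        rw [h, sub_self]
      obtain ⟨c, hc⟩ := (ZMod.intCast_zmod_eq_zero_iff_dvd _ p).mp h1
      refine ⟨(c : ℚ) / (a.den : ℤ), ?_, ?_⟩
      · intro hdiv
        have h5 : (((c : ℚ) / (a.den : ℤ)).den : ℤ) ∣ (a.den : ℤ) := by
          rw [← Rat.divInt_eq_div]
          exact Rat.den_dvd c a.den
        have h6 : ((c : ℚ) / (a.den : ℤ)).den ∣ a.den := by exact_mod_cast h5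
        exact ha (hdiv.trans h6)
      · have hc' : (a.num : ℚ) - s * a.den = p * c := by exact_mod_cast hc
        have e1 := Rat.num_div_den a
        rw [div_eq_iff hdq] at e1
        rw [pow_one, Int.cast_natCast]
        field_simp
        linear_combination hc' - e1
  rw [key]
  constructor
  · rintro rfl
    refine ⟨ZMod.val_lt _, ?_⟩
    simp [ratResidue]
  · rintro ⟨hr, h⟩
    rw [ratResidue, h, ZMod.val_natCast, Nat.mod_eq_of_lt hr]

/-- The Euler numbers: `E_0 = 1` and `E_n = -∑_{k=1}^{⌊n/2⌋} C(n, 2k) E_{n-2k}` for `n ≥ 1`.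
(The index `i : Fin ((n + 1) / 2)` below stands for `k - 1`.) -/
def eulerNumber : ℕ → ℚ
  | 0 => 1
  | n + 1 => -∑ i : Fin ((n + 1) / 2),
      ((n + 1).choose (2 * (i.val + 1)) : ℚ) * eulerNumber (n + 1 - 2 * (i.val + 1))
  decreasing_by omega

theorem eulerNumber_zero : eulerNumber 0 = 1 := by
  rw [eulerNumber]

theorem eulerNumber_of_pos (n : ℕ) (hn : 1 ≤ n) :
    eulerNumber n =
      -∑ k ∈ Finset.Icc 1 (n / 2), (n.choose (2 * k) : ℚ) * eulerNumber (n - 2 * k) := by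
  obtain ⟨m, rfl⟩ : ∃ m, n = m + 1 := ⟨n - 1, by omega⟩
  rw [eulerNumber, Fin.sum_univ_eq_sum_range
    (fun i => ((m + 1).choose (2 * (i + 1)) : ℚ) * eulerNumber (m + 1 - 2 * (i + 1))),
    Finset.range_eq_Ico,
    Finset.sum_Ico_add' (fun k => ((m + 1).choose (2 * k) : ℚ) * eulerNumber (m + 1 - 2 * k))
      0 ((m + 1) / 2) 1]
  rfl

/-- The value at `x` of the Euler polynomial
`E_n(x) = 2^{-n} ∑_{r=0}^{n} C(n, r) (2x - 1)^{n-r} E_r`. -/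
def eulerPoly (n : ℕ) (x : ℚ) : ℚ :=
  1 / 2 ^ n * ∑ r ∈ Finset.range (n + 1), (n.choose r : ℚ) * (2 * x - 1) ^ (n - r) * eulerNumber r

/-! Write n = (p-1)/2, A_m = ∑_{j≤m} (-1)^j/j, S(a) for the left-hand sum and U(x) = ∑_{k<p}
C(x,k)(-2)^k. Both sums satisfy a first-order recurrence under a shift by 1, and the inhomogeneous
terms are divisible by p and known mod p². Starting from a multiple of p, induction on the residue
gives U(s+pt) ≡ (-1)^s (1 + pt(2A_s - A_{p-1})) for s < p (`sum_choose_neg_two_pow_congr`), S(r+pt)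
≡ 2pt + (2a+1)(-1 + 2pt(A_{p-1} - 2A_{2r})) with a = r+pt, r ≤ n (`chooseSum_congr`).

If r < p/2, then 2a = 2r + p(2t), and comparing the two proves the claim. If r > p/2, the symmetry
S(a) = S(-1-a) replaces r by r' = p-1-r and t by -(t+1), whereas 2a has residue 2r-p and quotient
2t+1. The reflection j ↦ p-j of A matches the harmonic terms; passing from t+1 to 2t+1 costs the
factor (2t+2)/(2t+1) = 1 + 1/(2t+1). When p divides 2t+1, A_{p-1} - 2A_{2r'+1} is read off instead
from E_{p-2}(-2a), via E_m(x+1) + E_m(x) = 2x^m and Fermat. -/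

/-- The subring of `ℚ` of rational `p`-adic integers. -/
def ratPadicSubring (p : ℕ) [hp : Fact p.Prime] : Subring ℚ where
  carrier := {x | IsRatPadicInt p x}
  mul_mem' {x y} hx hy h := by
    rcases (hp.out.dvd_mul).1 (h.trans (Rat.mul_den_dvd x y)) with h | h
    exacts [hx h, hy h]
  add_mem' {x y} hx hy h := by
    rcases (hp.out.dvd_mul).1 (h.trans (Rat.add_den_dvd x y)) with h | h
    exacts [hx h, hy h]
  one_mem' := by simpa [IsRatPadicInt] using hp.out.one_lt.ne'
  zero_mem' := by simpa [IsRatPadicInt] using hp.out.one_lt.ne'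
  neg_mem' {x} hx := by simpa [IsRatPadicInt] using hx

/-! ### Units and congruences among rational p-adic integers. -/

section RatPadic

variable {p : ℕ} [hp : Fact p.Prime]

theorem ratPadic_cast_ne_zero : (p : ℚ) ≠ 0 := by exact_mod_cast hp.out.ne_zero

theorem ratCongr_iff {n : ℕ} {x y : ℚ} :
    RatCongr p n x y ↔ ∃ z ∈ ratPadicSubring p, x = y + (p : ℚ) ^ n * z :=
  ⟨fun ⟨z, hz, h⟩ => ⟨z, hz, by linear_combination h⟩,
    fun ⟨z, hz, h⟩ => ⟨z, hz, by linear_combination h⟩⟩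

theorem inv_intCast_mem {j : ℤ} (hj : ¬ (p : ℤ) ∣ j) : (j : ℚ)⁻¹ ∈ ratPadicSubring p := by
  change ¬ p ∣ _
  rw [Rat.inv_intCast_den]
  split_ifs with h
  · simp [h] at hj
  · rwa [Int.natCast_dvd] at hj

theorem inv_natCast_mem {j : ℕ} (h0 : 0 < j) (hj : j < p) : (j : ℚ)⁻¹ ∈ ratPadicSubring p := by
  have := inv_intCast_mem (p := p) (j := j)
    (by exact_mod_cast Nat.not_dvd_of_pos_of_lt h0 hj)
  simpa using this

theorem inv_mem_of_not_ratCongr {x : ℚ} (hx : x ∈ ratPadicSubring p) (h : ¬ RatCongr p 1 x 0) :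
    x⁻¹ ∈ ratPadicSubring p := by
  have hd : (x.den : ℚ)⁻¹ ∈ ratPadicSubring p := by
    have := inv_intCast_mem (p := p) (j := x.den) (by exact_mod_cast hx)
    simpa using this
  have hn : ¬ (p : ℤ) ∣ x.num := by
    rintro ⟨c, hc⟩
    refine h (ratCongr_iff.2 ⟨c * (x.den : ℚ)⁻¹, mul_mem (intCast_mem _ c) hd, ?_⟩)
    conv_lhs => rw [← Rat.num_div_den x, hc]
    push_cast
    ring
  have hx' : x⁻¹ = x.den * (x.num : ℚ)⁻¹ := by
    conv_lhs => rw [← Rat.num_div_den x]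
    rw [inv_div, div_eq_mul_inv]
  rw [hx']
  exact mul_mem (natCast_mem _ _) (inv_intCast_mem hn)

theorem not_ratCongr_zero_of_natCast {j : ℕ} (h0 : 0 < j) (hj : j < p) {x t : ℚ}
    (ht : t ∈ ratPadicSubring p) (hx : x = j + p * t) : ¬ RatCongr p 1 x 0 := by
  intro h
  obtain ⟨z, hz, h⟩ := ratCongr_iff.1 h
  have hj0 : (j : ℚ) ≠ 0 := by exact_mod_cast h0.ne'
  have hmem : (p : ℚ)⁻¹ ∈ ratPadicSubring p := by
    have : (p : ℚ)⁻¹ = (z - t) * (j : ℚ)⁻¹ := by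
      field_simp [ratPadic_cast_ne_zero (p := p)]
      linear_combination h - hx
    rw [this]
    exact mul_mem (sub_mem hz ht) (inv_natCast_mem h0 hj)
  change ¬ p ∣ _ at hmem
  rw [Rat.inv_natCast_den] at hmem
  split_ifs at hmem with h
  · exact hp.out.ne_zero h
  · exact hmem dvd_rfl

theorem inv_natCast_add_mem {j : ℕ} (h0 : 0 < j) (hj : j < p) {t : ℚ}
    (ht : t ∈ ratPadicSubring p) : (j + p * t)⁻¹ ∈ ratPadicSubring p :=
  inv_mem_of_not_ratCongr (add_mem (natCast_mem _ _) (mul_mem (natCast_mem _ _) ht))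
    (not_ratCongr_zero_of_natCast h0 hj ht rfl)

theorem natCast_add_ne_zero {j : ℕ} (h0 : 0 < j) (hj : j < p) {t : ℚ}
    (ht : t ∈ ratPadicSubring p) : (j + p * t : ℚ) ≠ 0 := by
  intro h
  exact not_ratCongr_zero_of_natCast h0 hj ht rfl
    (ratCongr_iff.2 ⟨0, zero_mem _, by rw [h]; ring⟩)

theorem RatCongr.rfl' {n : ℕ} (x : ℚ) : RatCongr p n x x :=
  ratCongr_iff.2 ⟨0, zero_mem _, by ring⟩

theorem RatCongr.symm {n : ℕ} {x y : ℚ} (h : RatCongr p n x y) : RatCongr p n y x := by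
  obtain ⟨z, hz, h⟩ := ratCongr_iff.1 h
  exact ratCongr_iff.2 ⟨-z, neg_mem hz, by rw [h]; ring⟩

theorem RatCongr.trans {n : ℕ} {x y w : ℚ} (h : RatCongr p n x y) (h' : RatCongr p n y w) :
    RatCongr p n x w := by
  obtain ⟨z, hz, h⟩ := ratCongr_iff.1 h
  obtain ⟨z', hz', h'⟩ := ratCongr_iff.1 h'
  exact ratCongr_iff.2 ⟨z + z', add_mem hz hz', by rw [h, h']; ring⟩

theorem RatCongr.add {n : ℕ} {x y x' y' : ℚ} (h : RatCongr p n x y) (h' : RatCongr p n x' y') :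
    RatCongr p n (x + x') (y + y') := by
  obtain ⟨z, hz, h⟩ := ratCongr_iff.1 h
  obtain ⟨z', hz', h'⟩ := ratCongr_iff.1 h'
  exact ratCongr_iff.2 ⟨z + z', add_mem hz hz', by rw [h, h']; ring⟩

theorem RatCongr.sub {n : ℕ} {x y x' y' : ℚ} (h : RatCongr p n x y) (h' : RatCongr p n x' y') :
    RatCongr p n (x - x') (y - y') := by
  obtain ⟨z, hz, h⟩ := ratCongr_iff.1 h
  obtain ⟨z', hz', h'⟩ := ratCongr_iff.1 h'
  exact ratCongr_iff.2 ⟨z - z', sub_mem hz hz', by rw [h, h']; ring⟩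

theorem RatCongr.const_mul {n : ℕ} {x y c : ℚ} (hc : c ∈ ratPadicSubring p)
    (h : RatCongr p n x y) : RatCongr p n (c * x) (c * y) := by
  obtain ⟨z, hz, h⟩ := ratCongr_iff.1 h
  exact ratCongr_iff.2 ⟨c * z, mul_mem hc hz, by rw [h]; ring⟩

theorem RatCongr.mul {n : ℕ} {x y x' y' : ℚ} (hx : x ∈ ratPadicSubring p)
    (hy' : y' ∈ ratPadicSubring p) (h : RatCongr p n x y) (h' : RatCongr p n x' y') :
    RatCongr p n (x * x') (y * y') := by
  refine (h'.const_mul hx).trans ?_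
  rw [mul_comm x, mul_comm y]
  exact h.const_mul hy'

theorem RatCongr.sum {ι : Type*} {n : ℕ} {s : Finset ι} {f g : ι → ℚ}
    (h : ∀ i ∈ s, RatCongr p n (f i) (g i)) : RatCongr p n (∑ i ∈ s, f i) (∑ i ∈ s, g i) := by
  classical
  induction s using Finset.induction_on with
  | empty => simpa using RatCongr.rfl' 0
  | insert a s ha ih =>
    rw [Finset.sum_insert ha, Finset.sum_insert ha]
    exact (h a (by simp)).add (ih fun i hi => h i (by simp [hi]))

theorem RatCongr.pow {n : ℕ} {x y : ℚ} (hx : x ∈ ratPadicSubring p) (hy : y ∈ ratPadicSubring p)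
    (h : RatCongr p n x y) (k : ℕ) : RatCongr p n (x ^ k) (y ^ k) := by
  induction k with
  | zero => simpa using RatCongr.rfl' 1
  | succ k ih =>
    rw [pow_succ, pow_succ]
    exact ih.mul (pow_mem hx k) hy h

end RatPadic

/-! ### Identities for generalized binomial coefficients. -/

section Choose

theorem succ_mul_ringChoose_succ (x : ℚ) (k : ℕ) :
    ((k : ℚ) + 1) * Ring.choose x (k + 1) = (x - k) * Ring.choose x k := by
  have h1 := Ring.descPochhammer_eq_factorial_smul_choose x k
  have h2 := Ring.descPochhammer_eq_factorial_smul_choose x (k + 1)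
  rw [descPochhammer_succ_right, Polynomial.smeval_mul, h1, Nat.factorial_succ] at h2
  simp [Polynomial.smeval_sub, Polynomial.smeval_natCast] at h2
  have hk : (k.factorial : ℚ) ≠ 0 := by exact_mod_cast k.factorial_ne_zero
  apply mul_left_cancel₀ hk
  linear_combination -h2

theorem ringChoose_add_one (x : ℚ) (k : ℕ) :
    Ring.choose (x + 1) (k + 1) = Ring.choose x k + Ring.choose x (k + 1) :=
  Ring.choose_succ_succ x k

theorem mul_ringChoose_sub_one (x : ℚ) (k : ℕ) :
    x * Ring.choose (x - 1) k = (x - k) * Ring.choose x k := by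
  cases k with
  | zero => simp
  | succ k =>
    have h := ringChoose_add_one (x - 1) k
    have h1 := succ_mul_ringChoose_succ (x - 1) k
    rw [sub_add_cancel] at h
    rw [h]
    push_cast
    linear_combination h1

/-- The Zeilberger-type recurrence for `∑ C(a,k) C(-1-a,k) / (2k-1)`. -/
theorem sum_choose_mul_choose_div_rec (a : ℚ) (n : ℕ) :
    (2 * a + 1) * ∑ k ∈ Finset.range (n + 1),
        Ring.choose (a + 1) k * Ring.choose (-1 - (a + 1)) k / (2 * (k : ℚ) - 1)
      = (2 * a + 3) * ∑ k ∈ Finset.range (n + 1),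
          Ring.choose a k * Ring.choose (-1 - a) k / (2 * (k : ℚ) - 1)
        + 2 * (Ring.choose a n * Ring.choose (-2 - a) n) := by
  induction n with
  | zero => simp; ring
  | succ n ih =>
    rw [Finset.sum_range_succ, mul_add, ih, Finset.sum_range_succ _ (n + 1)]
    have h1 := ringChoose_add_one a n
    have h2 := ringChoose_add_one (-2 - a) n
    have h3 := succ_mul_ringChoose_succ a n
    have h4 := succ_mul_ringChoose_succ (-2 - a) n
    have hn : (n : ℚ) + 1 ≠ 0 := by positivity
    have h3' : Ring.choose a (n + 1) = (a - n) * Ring.choose a n / (n + 1) := by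
      rw [eq_div_iff hn, ← h3]; ring
    have h4' : Ring.choose (-2 - a) (n + 1) = (-2 - a - n) * Ring.choose (-2 - a) n / (n + 1) := by
      rw [eq_div_iff hn, ← h4]; ring
    -- Everything becomes a rational multiple of C(a,n) C(-2-a,n).
    rw [show -1 - (a + 1) = -2 - a by ring, show -1 - a = -2 - a + 1 by ring, h1, h2, h3', h4']
    have hk : 2 * ((n + 1 : ℕ) : ℚ) - 1 ≠ 0 := by
      push_cast
      have : (0 : ℚ) ≤ n := n.cast_nonneg
      linarith
    push_cast at hk ⊢
    field_simp
    ring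

end Choose

/-! ### Binomial coefficients and binomial sums near multiples of p. -/

section ChooseCongr

variable {p : ℕ} [hp : Fact p.Prime]

theorem inv_natCast_add_one_mem {k : ℕ} (hk : k + 1 < p) :
    ((k : ℚ) + 1)⁻¹ ∈ ratPadicSubring p := by
  have := inv_natCast_mem (p := p) k.succ_pos hk
  push_cast at this
  exact this

theorem ringChoose_succ (x : ℚ) (k : ℕ) :
    Ring.choose x (k + 1) = ((k : ℚ) + 1)⁻¹ * ((x - k) * Ring.choose x k) := by
  have hk : (k : ℚ) + 1 ≠ 0 := by positivity
  rw [← succ_mul_ringChoose_succ, inv_mul_cancel_left₀ hk]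

theorem ringChoose_succ' (x : ℚ) (k : ℕ) :
    Ring.choose x (k + 1) = ((k : ℚ) + 1)⁻¹ * (x * Ring.choose (x - 1) k) := by
  rw [mul_ringChoose_sub_one, ringChoose_succ]

theorem ringChoose_mem {x : ℚ} (hx : x ∈ ratPadicSubring p) {k : ℕ} (hk : k < p) :
    Ring.choose x k ∈ ratPadicSubring p := by
  induction k with
  | zero => simp
  | succ k ih =>
    rw [ringChoose_succ]
    exact mul_mem (inv_natCast_add_one_mem hk)
      (mul_mem (sub_mem hx (natCast_mem _ _)) (ih (by omega)))

/-- Each factor (pt-1-i)/(i+1) is congruent to -1. -/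
theorem ringChoose_mul_sub_one_congr {t : ℚ} (ht : t ∈ ratPadicSubring p) {k : ℕ} (hk : k < p) :
    RatCongr p 1 (Ring.choose (p * t - 1) k) ((-1) ^ k) := by
  induction k with
  | zero => simpa using RatCongr.rfl' 1
  | succ k ih =>
    have hx : p * t - 1 ∈ ratPadicSubring p :=
      sub_mem (mul_mem (natCast_mem _ _) ht) (one_mem _)
    have hk0 : (k : ℚ) + 1 ≠ 0 := by positivity
    have h1 : RatCongr p 1 (Ring.choose (p * t - 1) (k + 1)) (-1 * Ring.choose (p * t - 1) k) := by
      refine ratCongr_iff.2 ⟨t * ((k : ℚ) + 1)⁻¹ * Ring.choose (p * t - 1) k,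
        mul_mem (mul_mem ht (inv_natCast_add_one_mem hk)) (ringChoose_mem hx (by omega)), ?_⟩
      rw [ringChoose_succ]
      field_simp
      ring
    refine h1.trans ?_
    rw [pow_succ, mul_comm _ (-1 : ℚ)]
    exact (ih (by omega)).const_mul (neg_mem (one_mem _))

theorem RatCongr.prime_mul {n : ℕ} {x y : ℚ} (h : RatCongr p n x y) :
    RatCongr p (n + 1) (p * x) (p * y) := by
  obtain ⟨z, hz, h⟩ := ratCongr_iff.1 h
  exact ratCongr_iff.2 ⟨z, hz, by rw [h]; ring⟩

theorem RatCongr.of_prime_mul {n : ℕ} {x y : ℚ} (h : RatCongr p (n + 1) (p * x) (p * y)) :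
    RatCongr p n x y := by
  obtain ⟨z, hz, h⟩ := ratCongr_iff.1 h
  refine ratCongr_iff.2 ⟨z, hz, mul_left_cancel₀ (ratPadic_cast_ne_zero (p := p)) ?_⟩
  rw [h]
  ring

theorem ringChoose_mul_congr {t : ℚ} (ht : t ∈ ratPadicSubring p) {k : ℕ} (hk : k + 1 < p) :
    RatCongr p 2 (Ring.choose (p * t) (k + 1)) (p * (t * ((-1) ^ k / (k + 1)))) := by
  have h := ((ringChoose_mul_sub_one_congr ht (show k < p by omega)).const_mul
    (mul_mem ht (inv_natCast_add_one_mem hk))).prime_mul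
  rw [ringChoose_succ']
  convert h using 1 <;> ring

theorem sum_ringChoose_mul_congr {t w : ℚ} (ht : t ∈ ratPadicSubring p)
    (hw : w ∈ ratPadicSubring p) :
    RatCongr p 2 (∑ k ∈ Finset.range p, Ring.choose (p * t) k * w ^ k)
      (1 + p * (t * ∑ k ∈ Finset.range (p - 1), (-1) ^ k / ((k : ℚ) + 1) * w ^ (k + 1))) := by
  obtain ⟨m, hm⟩ : ∃ m, p = m + 1 := ⟨p - 1, by have := hp.out.pos; omega⟩
  have hm' : p - 1 = m := by omega
  rw [hm']
  rw [show Finset.range p = Finset.range (m + 1) by rw [← hm], Finset.sum_range_succ', add_comm, Finset.mul_sum, Finset.mul_sum]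
  refine RatCongr.add (by simpa using RatCongr.rfl' 1) (RatCongr.sum fun k hk => ?_)
  rw [Finset.mem_range] at hk
  have h := (ringChoose_mul_congr ht (show k + 1 < p by omega)).const_mul (pow_mem hw (k + 1))
  convert h using 1 <;> ring

/-- The alternating harmonic number `∑_{j=1}^n (-1)^j / j`. -/
def altHarmonic (n : ℕ) : ℚ := ∑ j ∈ Finset.range n, (-1) ^ (j + 1) / ((j : ℚ) + 1)

theorem altHarmonic_succ (n : ℕ) :
    altHarmonic (n + 1) = altHarmonic n + (-1) ^ (n + 1) * ((n : ℚ) + 1)⁻¹ := by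
  rw [altHarmonic, Finset.sum_range_succ, altHarmonic, div_eq_mul_inv]

theorem altHarmonic_mem {n : ℕ} (hn : n < p) : altHarmonic n ∈ ratPadicSubring p := by
  refine sum_mem fun j hj => ?_
  rw [Finset.mem_range] at hj
  rw [div_eq_mul_inv]
  exact mul_mem (pow_mem (neg_mem (one_mem _)) _) (inv_natCast_add_one_mem (by omega))

theorem sum_ringChoose_natCast (p : ℕ) (w : ℚ) :
    ∑ k ∈ Finset.range p, Ring.choose (p : ℚ) k * w ^ k = (1 + w) ^ p - w ^ p := by
  rw [add_comm 1 w, add_pow, Finset.sum_range_succ]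
  simp [Ring.choose_natCast, mul_comm]

/-- By the binomial theorem, ∑_{k<p} C(p,k) w^k = (1+w)^p - w^p takes the same value 2^p - 1 at w =
1 and at w = -2. Expanding both mod p² and dividing by p compares the two truncated logarithms. -/
theorem sum_two_pow_div_congr (hp2 : p ≠ 2) :
    RatCongr p 1 (∑ k ∈ Finset.range (p - 1), (-1) ^ k / ((k : ℚ) + 1) * (-2) ^ (k + 1))
      (-altHarmonic (p - 1)) := by
  have hodd := hp.out.odd_of_ne_two hp2
  have h1 := sum_ringChoose_mul_congr (p := p) (one_mem _) (one_mem _)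
  have h2 := sum_ringChoose_mul_congr (p := p) (w := -2) (one_mem _) (neg_mem (ofNat_mem _ 2))
  rw [mul_one, sum_ringChoose_natCast] at h1 h2
  have h3 : ((1 : ℚ) + -2) ^ p - (-2) ^ p = (1 + 1) ^ p - 1 ^ p := by
    rw [hodd.neg_pow, show (1 : ℚ) + -2 = -1 by norm_num, hodd.neg_one_pow]
    norm_num
    ring
  rw [h3] at h2
  have h4 := (RatCongr.rfl' (p := p) (n := 2) (-1)).add (h2.symm.trans h1)
  have h5 : -altHarmonic (p - 1) =
      ∑ k ∈ Finset.range (p - 1), (-1) ^ k / ((k : ℚ) + 1) * 1 ^ (k + 1) := by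
    rw [altHarmonic, ← Finset.sum_neg_distrib]
    exact Finset.sum_congr rfl fun k _ => by ring
  rw [h5]
  refine RatCongr.of_prime_mul ?_
  simpa using h4

theorem sum_choose_neg_two_pow_base_congr (hp2 : p ≠ 2) {t : ℚ} (ht : t ∈ ratPadicSubring p) :
    RatCongr p 2 (∑ k ∈ Finset.range p, Ring.choose (p * t) k * (-2) ^ k)
      (1 - p * (t * altHarmonic (p - 1))) := by
  refine (sum_ringChoose_mul_congr ht (neg_mem (ofNat_mem _ 2))).trans ?_
  rw [sub_eq_add_neg, ← mul_neg, ← mul_neg]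
  exact (RatCongr.rfl' _).add ((sum_two_pow_div_congr hp2).const_mul ht).prime_mul

theorem sum_choose_add_one_mul_pow (x w : ℚ) (n : ℕ) :
    ∑ k ∈ Finset.range (n + 1), Ring.choose (x + 1) k * w ^ k
      = (1 + w) * ∑ k ∈ Finset.range (n + 1), Ring.choose x k * w ^ k
        - w ^ (n + 1) * Ring.choose x n := by
  induction n with
  | zero => simp
  | succ n ih =>
    rw [Finset.sum_range_succ, ih, Finset.sum_range_succ _ (n + 1), ringChoose_add_one]
    ring

/-- The ratio V'/V = 1 + p/u, with u a unit, cannot change mod p² a quantity that is already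
divisible by p. -/
theorem ratCongr_of_mul_eq {j : ℕ} (h0 : 0 < j) (hj : j < p) {t c V V' : ℚ}
    (ht : t ∈ ratPadicSubring p) (hc : c ∈ ratPadicSubring p)
    (h : (j + p * t) * V' = (j + p * t + p) * V) (hV : RatCongr p 2 V (p * c)) :
    RatCongr p 2 V' (p * c) := by
  obtain ⟨z, hz, rfl⟩ := ratCongr_iff.1 hV
  have hm := inv_natCast_add_mem h0 hj ht
  have hm0 := natCast_add_ne_zero h0 hj ht
  refine ratCongr_iff.2 ⟨z + (j + p * t)⁻¹ * (c + p * z),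
    add_mem hz (mul_mem hm (add_mem hc (mul_mem (natCast_mem _ _) hz))), ?_⟩
  apply mul_left_cancel₀ hm0
  rw [h]
  field_simp
  ring

theorem ratCongr_of_mul_congr {j : ℕ} (h0 : 0 < j) (hj : j < p) {t c X : ℚ}
    (ht : t ∈ ratPadicSubring p) (hc : c ∈ ratPadicSubring p)
    (h : RatCongr p 2 ((j + p * t) * X) (p * c)) : RatCongr p 2 X (p * (c * (j : ℚ)⁻¹)) := by
  obtain ⟨z, hz, h⟩ := ratCongr_iff.1 h
  have hm := inv_natCast_add_mem h0 hj ht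
  have hm0 := natCast_add_ne_zero h0 hj ht
  have hj0 : (j : ℚ) ≠ 0 := by exact_mod_cast h0.ne'
  have hj' := inv_natCast_mem h0 hj
  refine ratCongr_iff.2 ⟨(j + p * t)⁻¹ * z - c * t * ((j + p * t)⁻¹ * (j : ℚ)⁻¹),
    sub_mem (mul_mem hm hz) (mul_mem (mul_mem hc ht) (mul_mem hm hj')), ?_⟩
  apply mul_left_cancel₀ hm0
  rw [h]
  field_simp
  ring

/-- The extra factor j+pt makes the quantity constant in j mod p²: consecutive values have ratio
(j+1+pt)/(j+1+pt-p). It also lets the induction start at j = 0. -/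
theorem mul_choose_prime_sub_one_congr {t : ℚ} (ht : t ∈ ratPadicSubring p) {j : ℕ} (hj : j < p) :
    RatCongr p 2 ((j + p * t) * Ring.choose (j + p * t - 1) (p - 1)) (p * t) := by
  have hp1 : ((p - 1 : ℕ) : ℚ) = p - 1 := by rw [Nat.cast_sub hp.out.one_le]; simp
  induction j with
  | zero =>
    have h := ((ringChoose_mul_sub_one_congr ht (Nat.sub_lt hp.out.pos one_pos)).const_mul
      ht).prime_mul
    have h' : RatCongr p 2 (p * (t * (-1) ^ (p - 1))) (p * t) := by
      -- For p = 2 the sign is -1, but then 2pt = p²t.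
      rcases hp.out.eq_two_or_odd' with rfl | hodd
      · exact ratCongr_iff.2 ⟨-t, neg_mem ht, by norm_num; ring⟩
      · rw [(Nat.Odd.sub_odd hodd odd_one).neg_one_pow, mul_one]
        exact RatCongr.rfl' _
    refine RatCongr.trans ?_ h'
    simpa [mul_assoc] using h
  | succ j ih =>
    refine ratCongr_of_mul_eq j.succ_pos hj (sub_mem ht (one_mem _)) ht ?_ (ih (by omega))
    rw [mul_ringChoose_sub_one (j + p * t), hp1]
    push_cast
    rw [show (j : ℚ) + 1 + p * t - 1 = j + p * t by ring]
    ring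

theorem choose_prime_sub_one_congr {t : ℚ} (ht : t ∈ ratPadicSubring p) {j : ℕ} (hj : j + 1 < p) :
    RatCongr p 2 (Ring.choose (j + p * t) (p - 1)) (p * (t * ((j : ℚ) + 1)⁻¹)) := by
  have h := ratCongr_of_mul_congr j.succ_pos hj ht ht (mul_choose_prime_sub_one_congr ht hj)
  push_cast at h
  rwa [show (j : ℚ) + 1 + p * t - 1 = j + p * t by ring] at h

/-- With x = j+pt, consecutive values have ratio (x+n+1)/(x-n), whose terms differ by 2n+1 = p; the
bound on j keeps the denominator a unit. This evaluates the inhomogeneous term in the recurrence for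
S. -/
theorem choose_mul_choose_half_congr {n : ℕ} (hn : p = 2 * n + 1) {t : ℚ}
    (ht : t ∈ ratPadicSubring p) {j : ℕ} (hj : j ≤ n) :
    RatCongr p 2 ((j + p * t) * (Ring.choose (j + p * t - 1) n * Ring.choose (-1 - (j + p * t)) n))
      (p * t) := by
  have hpn : (p : ℚ) = 2 * n + 1 := by exact_mod_cast hn
  induction j with
  | zero =>
    have h1 := ringChoose_mul_sub_one_congr ht (show n < p by omega)
    have h2 := ringChoose_mul_sub_one_congr (neg_mem ht) (show n < p by omega)
    have hx : p * t - 1 ∈ ratPadicSubring p :=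
      sub_mem (mul_mem (natCast_mem _ _) ht) (one_mem _)
    have h := ((h1.mul (ringChoose_mem hx (by omega))
      (pow_mem (neg_mem (one_mem _)) n) h2).const_mul ht).prime_mul
    rw [← mul_pow, neg_one_mul, neg_neg, one_pow, mul_one] at h
    convert h using 1
    rw [show (p : ℚ) * -t - 1 = -1 - (((0 : ℕ) : ℚ) + p * t) by push_cast; ring]
    push_cast
    ring_nf
  | succ j ih =>
    refine ratCongr_of_mul_eq (j := j + n + 1) (t := t - 1) (by omega) (by omega)
      (sub_mem ht (one_mem _)) ht ?_ (ih (by omega))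
    have h1 := mul_ringChoose_sub_one (j + p * t) n
    have h2 := mul_ringChoose_sub_one (-1 - (j + p * t)) n
    push_cast
    rw [show (j : ℚ) + 1 + p * t - 1 = j + p * t by ring,
      show -1 - ((j : ℚ) + 1 + p * t) = -1 - (j + p * t) - 1 by ring]
    rw [← mul_assoc (j + p * t : ℚ) (Ring.choose _ n), h1,
      show (j : ℚ) + n + 1 + p * (t - 1) = j + p * t - n by rw [hpn]; ring]
    rw [show (j : ℚ) + p * t - n + p = j + p * t + n + 1 by rw [hpn]; ring]
    linear_combination (-(j + p * t - n) * Ring.choose (j + p * t : ℚ) n) * h2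

end ChooseCongr

/-! ### Closed forms of both sums mod p². -/

section MainCongr

variable {p : ℕ} [hp : Fact p.Prime]

theorem RatCongr.prime_mul_mul {c X Y y : ℚ} (hc : c ∈ ratPadicSubring p)
    (hY : Y ∈ ratPadicSubring p) (h : RatCongr p 2 X (p * c)) (h' : RatCongr p 1 Y y) :
    RatCongr p 2 (X * Y) (p * (c * y)) := by
  have h1 := h.const_mul hY
  have h2 := (h'.const_mul hc).prime_mul
  rw [mul_comm X]
  refine h1.trans ?_
  convert h2 using 1
  ring

theorem RatCongr.of_unit_mul {n : ℕ} {u x y : ℚ} (hu : u⁻¹ ∈ ratPadicSubring p) (hu0 : u ≠ 0)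
    (h : RatCongr p n (u * x) (u * y)) : RatCongr p n x y := by
  have := h.const_mul hu
  rwa [inv_mul_cancel_left₀ hu0, inv_mul_cancel_left₀ hu0] at this

theorem natCast_pow_prime_congr (j : ℕ) : RatCongr p 1 ((j : ℚ) ^ p) j := by
  have h : (((j : ℤ) ^ p - j : ℤ) : ZMod p) = 0 := by
    push_cast
    rw [ZMod.pow_card, sub_self]
  obtain ⟨c, hc⟩ := (ZMod.intCast_zmod_eq_zero_iff_dvd _ p).1 h
  refine ratCongr_iff.2 ⟨c, intCast_mem _ c, ?_⟩
  have hc' : (j : ℚ) ^ p - j = p * c := by exact_mod_cast hc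
  linear_combination hc'

theorem sum_choose_neg_two_pow_congr (hp2 : p ≠ 2) {t : ℚ} (ht : t ∈ ratPadicSubring p) {s : ℕ}
    (hs : s < p) :
    RatCongr p 2 (∑ k ∈ Finset.range p, Ring.choose (s + p * t) k * (-2) ^ k)
      ((-1) ^ s * (1 + p * (t * (2 * altHarmonic s - altHarmonic (p - 1))))) := by
  induction s with
  | zero =>
    convert sum_choose_neg_two_pow_base_congr hp2 ht using 1
    · simp
    · simp [altHarmonic]
      ring
  | succ s ih =>
    obtain ⟨m, hm⟩ : ∃ m, p = m + 1 := ⟨p - 1, by have := hp.out.pos; omega⟩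
    have hrec := sum_choose_add_one_mul_pow (s + p * t) (-2) m
    rw [← hm, (hp.out.odd_of_ne_two hp2).neg_pow, show m = p - 1 by omega] at hrec
    have hi := inv_natCast_add_one_mem hs
    -- The binomial coefficient carries a factor p, so 2^p is needed only mod p, where it is 2.
    have h2 := (choose_prime_sub_one_congr ht hs).prime_mul_mul (mul_mem ht hi)
      (pow_mem (ofNat_mem _ 2) p) (natCast_pow_prime_congr 2)
    have h1 := (ih (by omega)).const_mul (neg_mem (one_mem (ratPadicSubring p)))
    have h3 := h1.add h2
    convert h3 using 1
    · push_cast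
      rw [show (s : ℚ) + 1 + p * t = s + p * t + 1 by ring, hrec]
      ring
    · rw [altHarmonic_succ]
      have h4 : ((-1 : ℚ) ^ s) * (-1) ^ s = 1 := by rw [← mul_pow]; norm_num
      push_cast
      rw [pow_succ]
      linear_combination (2 * p * t * ((s : ℚ) + 1)⁻¹) * h4

theorem altHarmonic_two_mul_succ (n : ℕ) :
    altHarmonic (2 * (n + 1))
      = altHarmonic (2 * n) - (2 * (n : ℚ) + 1)⁻¹ + (2 * ((n : ℚ) + 1))⁻¹ := by
  rw [show 2 * (n + 1) = 2 * n + 1 + 1 by ring, altHarmonic_succ, altHarmonic_succ,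
    Even.neg_one_pow (n := 2 * n + 1 + 1) ⟨n + 1, by ring⟩, Odd.neg_one_pow ⟨n, rfl⟩]
  push_cast
  rw [show 2 * (n : ℚ) + 1 + 1 = 2 * (n + 1) by ring]
  ring

theorem altHarmonic_two_mul (n : ℕ) :
    ∑ k ∈ Finset.range n, 1 / (((k : ℚ) + 1) * (2 * k + 1)) = -2 * altHarmonic (2 * n) := by
  induction n with
  | zero => simp [altHarmonic]
  | succ n ih =>
    rw [Finset.sum_range_succ, ih, altHarmonic_two_mul_succ]
    field_simp
    ring

/-- The truncated sum `∑_{k ≤ n} C(a,k) C(-1-a,k) / (2k-1)`. -/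
noncomputable def chooseSum (n : ℕ) (a : ℚ) : ℚ :=
  ∑ k ∈ Finset.range (n + 1), Ring.choose a k * Ring.choose (-1 - a) k / (2 * (k : ℚ) - 1)

theorem chooseSum_symm (n : ℕ) (a : ℚ) : chooseSum n (-1 - a) = chooseSum n a := by
  refine Finset.sum_congr rfl fun k _ => ?_
  rw [show -1 - (-1 - a) = a by ring, mul_comm (Ring.choose a k)]

/-- For k ≥ 1, C(pt,k) C(-1-pt,k) ≡ -pt/k, and the remaining sum of 1/(k(2k-1)) is an alternating
harmonic sum by partial fractions. -/
theorem chooseSum_base_congr {n : ℕ} (hn : p = 2 * n + 1) {t : ℚ} (ht : t ∈ ratPadicSubring p) :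
    RatCongr p 2 (chooseSum n (p * t)) (-1 + 2 * (p * (t * altHarmonic (p - 1)))) := by
  have h0 : -1 + 2 * (p * (t * altHarmonic (p - 1)))
      = ∑ k ∈ Finset.range n, -(p * (t * (1 / (((k : ℚ) + 1) * (2 * k + 1))))) + -1 := by
    rw [Finset.sum_neg_distrib, ← Finset.mul_sum, ← Finset.mul_sum, altHarmonic_two_mul,
      show p - 1 = 2 * n by omega]
    ring
  rw [h0, chooseSum, Finset.sum_range_succ']
  refine RatCongr.add (RatCongr.sum fun k hk => ?_) (by simpa using RatCongr.rfl' (-1))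
  rw [Finset.mem_range] at hk
  have hk1 : k + 1 < p := by omega
  have hneg : (p : ℚ) * -t - 1 ∈ ratPadicSubring p :=
    sub_mem (mul_mem (natCast_mem _ _) (neg_mem ht)) (one_mem _)
  have hc : t * ((-1) ^ k / ((k : ℚ) + 1)) ∈ ratPadicSubring p := by
    rw [div_eq_mul_inv]
    exact mul_mem ht (mul_mem (pow_mem (neg_mem (one_mem _)) _) (inv_natCast_add_one_mem hk1))
  have h := (ringChoose_mul_congr ht hk1).prime_mul_mul hc (ringChoose_mem hneg hk1)
    (ringChoose_mul_sub_one_congr (neg_mem ht) hk1)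
  have h2 : ((2 * k + 1 : ℕ) : ℚ)⁻¹ ∈ ratPadicSubring p := inv_natCast_mem (by omega) (by omega)
  have h3 := h.const_mul h2
  have h4 : ((-1 : ℚ) ^ k) * (-1) ^ k = 1 := by rw [← mul_pow]; norm_num
  push_cast at h3
  convert h3 using 1
  · push_cast
    rw [show (p : ℚ) * -t - 1 = -1 - p * t by ring, div_eq_mul_inv,
      show 2 * ((k : ℚ) + 1) - 1 = 2 * k + 1 by ring]
    ring
  · rw [pow_succ]
    field_simp
    linear_combination (p * t : ℚ) * h4

theorem chooseSum_congr {n : ℕ} (hn : p = 2 * n + 1) {t : ℚ} (ht : t ∈ ratPadicSubring p) {r : ℕ}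
    (hr : r ≤ n) :
    RatCongr p 2 (chooseSum n (r + p * t))
      (2 * p * t + (2 * (r + p * t) + 1) *
        (-1 + 2 * p * (t * (altHarmonic (p - 1) - 2 * altHarmonic (2 * r))))) := by
  induction r with
  | zero =>
    have hA := altHarmonic_mem (p := p) (n := p - 1) (Nat.sub_lt hp.out.pos one_pos)
    refine RatCongr.trans (y := -1 + 2 * (p * (t * altHarmonic (p - 1)))) ?_ ?_
    · simpa using chooseSum_base_congr hn ht
    -- At a = pt, the -2pt from (2a+1)(-1) cancels the leading 2pt.
    · refine RatCongr.symm (ratCongr_iff.2 ⟨4 * t * (t * altHarmonic (p - 1)),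
        mul_mem (mul_mem (ofNat_mem _ 4) ht) (mul_mem ht hA), ?_⟩)
      simp [altHarmonic]
      ring
  | succ r ih =>
    have ht2 : 2 * t ∈ ratPadicSubring p := mul_mem (ofNat_mem _ 2) ht
    have hu := inv_natCast_add_mem (p := p) (j := 2 * r + 1) (by omega) (by omega) ht2
    have hu0 := natCast_add_ne_zero (p := p) (j := 2 * r + 1) (by omega) (by omega) ht2
    have hi1 := inv_natCast_mem (p := p) (j := 2 * r + 1) (by omega) (by omega)
    have hi2 := inv_natCast_mem (p := p) (j := r + 1) (by omega) (by omega)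
    have hD := ratCongr_of_mul_congr r.succ_pos (by omega) ht ht
      (choose_mul_choose_half_congr hn ht hr)
    have hrec := sum_choose_mul_choose_div_rec (r + p * t) n
    -- The recurrence may be divided by 2(r+pt)+1, a unit because 0 < 2r+1 < p.
    refine RatCongr.of_unit_mul hu hu0 ?_
    have h1 := (ih (by omega)).const_mul (c := 2 * (r + p * t) + 3)
      (add_mem (mul_mem (ofNat_mem _ 2) (add_mem (natCast_mem _ _) (mul_mem (natCast_mem _ _) ht)))
        (ofNat_mem _ 3))
    have h2 := hD.const_mul (ofNat_mem _ 2)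
    have h3 := h1.add h2
    have hL : (2 * (r + p * t) + 1) * chooseSum n (((r + 1 : ℕ) : ℚ) + p * t)
        = (2 * (r + p * t) + 3) * chooseSum n (r + p * t)
          + 2 * (Ring.choose (((r + 1 : ℕ) : ℚ) + p * t - 1) n
            * Ring.choose (-1 - (((r + 1 : ℕ) : ℚ) + p * t)) n) := by
      push_cast
      rw [show (r : ℚ) + 1 + p * t = r + p * t + 1 by ring, show (r : ℚ) + p * t + 1 - 1
        = r + p * t by ring, show -1 - ((r : ℚ) + p * t + 1) = -2 - (r + p * t) by ring]
      exact hrec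
    rw [← hL] at h3
    push_cast at h3 hi1 hi2 ⊢
    rw [show 2 * (r : ℚ) + 1 + p * (2 * t) = 2 * (r + p * t) + 1 by ring]
    refine h3.trans (RatCongr.symm (ratCongr_iff.2
      ⟨2 * t * t * (8 * (r + 1) + 4 * (p * t)) * ((2 * (r : ℚ) + 1)⁻¹ * ((r : ℚ) + 1)⁻¹),
      mul_mem (mul_mem (mul_mem ht2 ht) (add_mem (mul_mem (ofNat_mem _ 8)
        (add_mem (natCast_mem _ _) (one_mem _))) (mul_mem (ofNat_mem _ 4)
          (mul_mem (natCast_mem _ _) ht)))) (mul_mem hi1 hi2), ?_⟩))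
    rw [altHarmonic_two_mul_succ]
    have e1 : 2 * (r : ℚ) + 1 ≠ 0 := by positivity
    have e2 : (r : ℚ) + 1 ≠ 0 := by positivity
    field_simp
    ring

/-- Replacing j by p-j changes the sign of both (-1)^j and 1/j mod p, so the first s terms match the
last s. -/
theorem altHarmonic_reflect (hp2 : p ≠ 2) {s : ℕ} (hs : s < p) :
    RatCongr p 1 (altHarmonic s) (altHarmonic (p - 1) - altHarmonic (p - 1 - s)) := by
  have hodd := hp.out.odd_of_ne_two hp2
  induction s with
  | zero => simpa [altHarmonic] using RatCongr.rfl' 0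
  | succ s ih =>
    have hi := inv_natCast_add_one_mem hs
    obtain ⟨m, hm⟩ : ∃ m, p = m + s + 2 := ⟨p - s - 2, by omega⟩
    have hj := inv_natCast_add_one_mem (p := p) (k := m) (by omega)
    have hpq : (p : ℚ) = m + s + 2 := by exact_mod_cast hm
    have h1 := ih (by omega)
    rw [show p - 1 - s = m + 1 by omega, altHarmonic_succ] at h1
    rw [show p - 1 - (s + 1) = m by omega, altHarmonic_succ]
    have h2 : RatCongr p 1 ((-1) ^ (s + 1) * ((s : ℚ) + 1)⁻¹)
        ((-1) ^ (m + 1) * ((m : ℚ) + 1)⁻¹) := by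
      have hsgn : (-1 : ℚ) ^ (m + 1) = (-1) ^ s := by
        rw [neg_one_pow_eq_pow_mod_two, neg_one_pow_eq_pow_mod_two s,
          show (m + 1) % 2 = s % 2 by have := Nat.odd_iff.1 hodd; omega]
      refine ratCongr_iff.2 ⟨(-1) ^ (s + 1) * (((s : ℚ) + 1)⁻¹ * ((m : ℚ) + 1)⁻¹),
        mul_mem (pow_mem (neg_mem (one_mem _)) _) (mul_mem hi hj), ?_⟩
      rw [hsgn, hpq, pow_succ]
      have e1 : (s : ℚ) + 1 ≠ 0 := by positivity
      have e2 : (m : ℚ) + 1 ≠ 0 := by positivity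
      field_simp
      ring
    convert h1.add h2 using 1
    ring

end MainCongr
-- Euler polynomials by umbral calculus.
open Polynomial in
/-- The umbral functional `X ^ r ↦ E_r` on polynomials. -/
noncomputable def eulerFunctional : ℚ[X] →ₗ[ℚ] ℚ :=
  Polynomial.lsum fun r => eulerNumber r • LinearMap.id

section Euler
open Polynomial

theorem eulerFunctional_X_pow (r : ℕ) : eulerFunctional (X ^ r) = eulerNumber r := by
  simp [eulerFunctional, Polynomial.lsum_apply, ← monomial_one_right_eq_X_pow,
    Polynomial.sum_monomial_index]

theorem eulerFunctional_X_add_C_pow (z : ℚ) (m : ℕ) :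
    eulerFunctional ((X + C z) ^ m)
      = ∑ r ∈ Finset.range (m + 1), (m.choose r : ℚ) * z ^ (m - r) * eulerNumber r := by
  rw [add_pow, map_sum]
  refine Finset.sum_congr rfl fun r _ => ?_
  rw [show (X : ℚ[X]) ^ r * C z ^ (m - r) * (m.choose r : ℚ[X])
    = (z ^ (m - r) * (m.choose r : ℚ)) • X ^ r by
      rw [smul_eq_C_mul, C_mul, C_pow, ← C_eq_natCast]; ring, map_smul, eulerFunctional_X_pow,
    smul_eq_mul]
  ring

theorem sum_one_add_neg_one_pow_mul (g : ℕ → ℚ) (n : ℕ) :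
    ∑ i ∈ Finset.range (n + 1), (1 + (-1) ^ i) * g i
      = 2 * ∑ k ∈ Finset.range (n / 2 + 1), g (2 * k) := by
  induction n with
  | zero => norm_num
  | succ n ih =>
    rw [Finset.sum_range_succ, ih]
    rcases Nat.even_or_odd' n with ⟨m, rfl | rfl⟩
    · rw [pow_succ, pow_mul, show (2 * m + 1) / 2 = 2 * m / 2 by omega]
      norm_num
    · rw [show (2 * m + 1 + 1) / 2 = (2 * m + 1) / 2 + 1 by omega, Finset.sum_range_succ _ (_ + 1),
        show 2 * ((2 * m + 1) / 2 + 1) = 2 * m + 1 + 1 by omega,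
        Even.neg_one_pow (n := 2 * m + 1 + 1) ⟨m + 1, by ring⟩]
      ring

/-- Umbrally (E+1)^N + (E-1)^N = 2·0^N: odd powers of the shift cancel, and the even ones form the
recurrence defining the Euler numbers. -/
theorem eulerFunctional_add (N : ℕ) :
    eulerFunctional ((X + C 1) ^ N) + eulerFunctional ((X + C (-1)) ^ N) = 2 * 0 ^ N := by
  have h : eulerFunctional ((X + C 1) ^ N) + eulerFunctional ((X + C (-1)) ^ N)
      = ∑ i ∈ Finset.range (N + 1),
        (1 + (-1) ^ i) * ((N.choose i : ℚ) * eulerNumber (N - i)) := by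
    rw [eulerFunctional_X_add_C_pow, eulerFunctional_X_add_C_pow, ← Finset.sum_add_distrib,
      ← Finset.sum_range_reflect]
    refine Finset.sum_congr rfl fun i hi => ?_
    rw [Finset.mem_range] at hi
    rw [show N + 1 - 1 - i = N - i by omega, Nat.choose_symm (by omega),
      show N - (N - i) = i by omega]
    ring
  rw [h, sum_one_add_neg_one_pow_mul, Finset.sum_range_succ']
  rcases Nat.eq_zero_or_pos N with rfl | hN
  · simp [eulerNumber_zero]
  · have := eulerNumber_of_pos N hN
    rw [← Finset.Ico_add_one_right_eq_Icc, Finset.sum_Ico_eq_sum_range] at this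
    simp only [Nat.add_sub_cancel, add_comm 1] at this
    simp [this, hN.ne']

theorem eulerFunctional_comp_add (P : ℚ[X]) :
    eulerFunctional (P.comp (X + C 1)) + eulerFunctional (P.comp (X + C (-1))) = 2 * P.eval 0 := by
  induction P using Polynomial.induction_on' with
  | add P Q hP hQ =>
    simp only [add_comp, map_add, eval_add]
    linear_combination hP + hQ
  | monomial n a =>
    have := eulerFunctional_add n
    rw [← C_mul_X_pow_eq_monomial]
    simp only [mul_comp, C_comp, X_pow_comp, eval_mul, eval_C, eval_pow, eval_X]
    simp only [← smul_eq_C_mul, map_smul, smul_eq_mul]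
    linear_combination a * this

theorem eulerPoly_eq_eulerFunctional (m : ℕ) (x : ℚ) :
    eulerPoly m x = 1 / 2 ^ m * eulerFunctional ((X + C (2 * x - 1)) ^ m) := by
  rw [eulerPoly, eulerFunctional_X_add_C_pow]

theorem eulerPoly_add_one_add (m : ℕ) (x : ℚ) :
    eulerPoly m (x + 1) + eulerPoly m x = 2 * x ^ m := by
  have h := eulerFunctional_comp_add ((X + C (2 * x)) ^ m)
  simp only [pow_comp, add_comp, X_comp, C_comp, eval_pow, eval_add, eval_X, eval_C] at h
  rw [eulerPoly_eq_eulerFunctional, eulerPoly_eq_eulerFunctional, ← mul_add]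
  rw [add_assoc, add_assoc, ← C_add, ← C_add, zero_add, mul_pow] at h
  rw [show 2 * (x + 1) - 1 = 1 + 2 * x by ring, show 2 * x - 1 = -1 + 2 * x by ring, h]
  field_simp

end Euler

/-! ### E_{p-2} modulo p. -/

section EulerCongr

variable {p : ℕ} [hp : Fact p.Prime]

theorem eulerNumber_mem (n : ℕ) : eulerNumber n ∈ ratPadicSubring p := by
  induction n using Nat.strong_induction_on with
  | _ n ih =>
    rcases Nat.eq_zero_or_pos n with rfl | hn
    · rw [eulerNumber_zero]
      exact one_mem _
    · rw [eulerNumber_of_pos n hn]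
      refine neg_mem (sum_mem fun k hk => mul_mem (natCast_mem _ _) (ih _ ?_))
      rw [Finset.mem_Icc] at hk
      omega

theorem two_inv_mem (hp2 : 2 < p) : (2 : ℚ)⁻¹ ∈ ratPadicSubring p := by
  simpa using inv_natCast_mem (p := p) two_pos hp2

theorem eulerPoly_congr (hp2 : 2 < p) (m : ℕ) {x y : ℚ} (hx : x ∈ ratPadicSubring p)
    (hy : y ∈ ratPadicSubring p) (h : RatCongr p 1 x y) :
    RatCongr p 1 (eulerPoly m x) (eulerPoly m y) := by
  have hlin {z : ℚ} (hz : z ∈ ratPadicSubring p) : 2 * z - 1 ∈ ratPadicSubring p :=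
    sub_mem (mul_mem (ofNat_mem _ 2) hz) (one_mem _)
  have h' : RatCongr p 1 (2 * x - 1) (2 * y - 1) :=
    (h.const_mul (ofNat_mem _ 2)).sub (RatCongr.rfl' 1)
  rw [eulerPoly, eulerPoly, one_div, ← inv_pow]
  refine RatCongr.const_mul (pow_mem (two_inv_mem hp2) m) (RatCongr.sum fun r _ => ?_)
  have := (h'.pow (hlin hx) (hlin hy) (m - r)).const_mul
    (mul_mem (natCast_mem _ (m.choose r)) (eulerNumber_mem (p := p) r))
  convert this using 1 <;> ring

theorem natCast_pow_prime_sub_two_congr {j : ℕ} (h0 : 0 < j) (hj : j < p) :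
    RatCongr p 1 ((j : ℚ) ^ (p - 2)) (j : ℚ)⁻¹ := by
  have hj0 : (j : ℚ) ≠ 0 := by exact_mod_cast h0.ne'
  have hi := inv_natCast_mem h0 hj
  have h := (natCast_pow_prime_congr (p := p) j).const_mul (mul_mem hi hi)
  convert h using 1
  · obtain ⟨m, hm⟩ : ∃ m, p = m + 2 := ⟨p - 2, by have := hp.out.two_le; omega⟩
    rw [show p - 2 = m by omega, show (j : ℚ) ^ p = j ^ (m + 2) by rw [← hm]]
    field_simp
    ring
  · field_simp

/-- Iterating E(x+1) = 2x^{p-2} - E(x) from x = 0, with j^{p-2} ≡ 1/j. -/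
theorem eulerPoly_natCast_congr (hp2 : 2 < p) {N : ℕ} (hN : N < p) :
    RatCongr p 1 (eulerPoly (p - 2) (N + 1))
      ((-1) ^ (N + 1) * (eulerPoly (p - 2) 0 - 2 * altHarmonic N)) := by
  induction N with
  | zero =>
    have h := eulerPoly_add_one_add (p - 2) 0
    rw [zero_pow (by omega)] at h
    have h' : eulerPoly (p - 2) (((0 : ℕ) : ℚ) + 1)
        = (-1) ^ (0 + 1) * (eulerPoly (p - 2) 0 - 2 * altHarmonic 0) := by
      simp only [Nat.cast_zero, altHarmonic, Finset.range_zero, Finset.sum_empty]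
      linear_combination h
    rw [h']
    exact RatCongr.rfl' _
  | succ N ih =>
    have h := eulerPoly_add_one_add (p - 2) ((N : ℚ) + 1)
    have h1 := (ih (by omega)).const_mul (neg_mem (one_mem (ratPadicSubring p)))
    have h2 := (natCast_pow_prime_sub_two_congr N.succ_pos hN).const_mul (ofNat_mem _ 2)
    convert h1.add h2 using 1
    · push_cast
      linear_combination h
    · have h4 : ((-1 : ℚ) ^ N) * (-1) ^ N = 1 := by rw [← mul_pow]; norm_num
      rw [altHarmonic_succ]
      push_cast
      simp only [pow_succ]
      linear_combination (2 * ((N : ℚ) + 1)⁻¹) * h4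

/-- E_{p-2}(p) ≡ E_{p-2}(0), while iterating the shift up to p gives E_{p-2}(p) ≡ 2A_{p-1} -
E_{p-2}(0). -/
theorem eulerPoly_zero_congr (hp2 : 2 < p) :
    RatCongr p 1 (eulerPoly (p - 2) 0) (altHarmonic (p - 1)) := by
  have h := eulerPoly_natCast_congr hp2 (Nat.sub_lt hp.out.pos one_pos)
  have hodd := hp.out.odd_of_ne_two hp2.ne'
  rw [Nat.sub_add_cancel hp.out.one_le, hodd.neg_one_pow,
    show ((p - 1 : ℕ) : ℚ) + 1 = p by rw [Nat.cast_sub hp.out.one_le]; simp] at h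
  have h0 : RatCongr p 1 (eulerPoly (p - 2) p) (eulerPoly (p - 2) 0) :=
    eulerPoly_congr hp2 _ (natCast_mem _ _) (zero_mem _)
      (ratCongr_iff.2 ⟨1, one_mem _, by ring⟩)
  have h1 := ((h0.symm.trans h).add (RatCongr.rfl' (eulerPoly (p - 2) 0))).const_mul
    (two_inv_mem hp2)
  convert h1 using 1 <;> ring

theorem eulerPoly_odd_add_one_congr (hp2 : 2 < p) {N : ℕ} (hN : N < p) (hodd : Odd N) :
    RatCongr p 1 (eulerPoly (p - 2) (N + 1)) (altHarmonic (p - 1) - 2 * altHarmonic N) := by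
  have h := eulerPoly_natCast_congr hp2 hN
  rw [(hodd.add_odd odd_one).neg_one_pow, one_mul] at h
  exact h.trans ((eulerPoly_zero_congr hp2).sub (RatCongr.rfl' _))

end EulerCongr

/-! ### Assembling the three cases. -/

theorem chooseSum_congr_of_lt_half {p n : ℕ} [Fact p.Prime] (hn : p = 2 * n + 1) {t : ℚ}
    (ht : t ∈ ratPadicSubring p) {r : ℕ} (hr : r ≤ n) {a : ℚ} (ha : a = r + p * t) :
    RatCongr p 2 (chooseSum n a)
      (2 * p * t - (2 * a + 1) * ∑ k ∈ Finset.range p, Ring.choose (2 * a) k * (-2) ^ k) := by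
  have hmem : 2 * a + 1 ∈ ratPadicSubring p := by
    rw [ha]
    exact add_mem (mul_mem (ofNat_mem _ 2) (add_mem (natCast_mem _ _)
      (mul_mem (natCast_mem _ _) ht))) (one_mem _)
  have hS := chooseSum_congr hn ht hr
  have hU := sum_choose_neg_two_pow_congr (p := p) (by omega) (mul_mem (ofNat_mem _ 2) ht)
    (show 2 * r < p by omega)
  rw [pow_mul, show ((2 * r : ℕ) : ℚ) + p * (2 * t) = 2 * a by rw [ha]; push_cast; ring] at hU
  rw [← ha] at hS
  refine hS.trans (RatCongr.symm ?_)
  have h := (RatCongr.rfl' (p := p) (n := 2) (2 * p * t)).sub (hU.const_mul hmem)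
  convert h using 1
  norm_num
  ring

theorem chooseSum_congr_of_half_lt {p n : ℕ} [Fact p.Prime] (hn : p = 2 * n + 1) {t : ℚ}
    (ht : t ∈ ratPadicSubring p) {r r' : ℕ} (hr : r + r' = 2 * n) (hr' : r' ≤ n) {a : ℚ}
    (ha : a = r + p * t) :
    RatCongr p 2 (chooseSum n a)
      (-(2 * p * (t + 1)) + (2 * a + 1) *
        (1 + 2 * p * ((t + 1) * (altHarmonic (p - 1) - 2 * altHarmonic (2 * r'))))) := by
  have hq : (r : ℚ) + r' = 2 * n := by exact_mod_cast hr
  have hpn : (p : ℚ) = 2 * n + 1 := by exact_mod_cast hn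
  have hS := chooseSum_congr hn (neg_mem (add_mem ht (one_mem _))) hr'
  rw [show (r' : ℚ) + p * -(t + 1) = -1 - a by linear_combination hq + (-1 : ℚ) * hpn + ha,
    chooseSum_symm] at hS
  convert hS using 1
  ring

theorem theorem4p4 (p : ℕ) (hp : p.Prime) (hp3 : 3 < p) (a : ℚ) (ha : IsRatPadicInt p a)
    (ha0 : ¬ RatCongr p 1 a 0) (t : ℚ) (ht : t = (a - (ratResidue p a : ℚ)) / p) :
    ((ratResidue p a : ℚ) < (p : ℚ) / 2 →
      RatCongr p 2
        (∑ k ∈ Finset.range ((p - 1) / 2 + 1),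
          Ring.choose a k * Ring.choose (-1 - a) k / (2 * (k : ℚ) - 1))
        (2 * p * t - (2 * a + 1) * ∑ k ∈ Finset.range p, Ring.choose (2 * a) k * (-2) ^ k)) ∧
    ((p : ℚ) / 2 < (ratResidue p a : ℚ) → ¬ RatCongr p 1 t (-1 / 2) →
      RatCongr p 2
        (∑ k ∈ Finset.range ((p - 1) / 2 + 1),
          Ring.choose a k * Ring.choose (-1 - a) k / (2 * (k : ℚ) - 1))
        (2 * p * (t + 1) - (2 * a + 1) / (2 * t + 1)
          - (2 * a + 1) * (1 + 1 / (2 * t + 1))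
            * ∑ k ∈ Finset.range p, Ring.choose (2 * a) k * (-2) ^ k)) ∧
    ((p : ℚ) / 2 < (ratResidue p a : ℚ) → RatCongr p 1 t (-1 / 2) →
      RatCongr p 2
        (∑ k ∈ Finset.range ((p - 1) / 2 + 1),
          Ring.choose a k * Ring.choose (-1 - a) k / (2 * (k : ℚ) - 1))
        (2 * a + 1 + p * (1 + (2 * a + 1) * eulerPoly (p - 2) (-2 * a)))) := by
  have : Fact p.Prime := ⟨hp⟩
  obtain ⟨n, hn⟩ : ∃ n, p = 2 * n + 1 := hp.odd_of_ne_two (by omega)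
  obtain ⟨hr, hcongr⟩ := (ratResidue_spec hp ha _).1 rfl
  generalize ratResidue p a = r at ht hr hcongr ⊢
  have hp0 : (p : ℚ) ≠ 0 := ratPadic_cast_ne_zero
  have hpn : (p : ℚ) = 2 * n + 1 := by exact_mod_cast hn
  have hat : a = r + p * t := by rw [ht]; field_simp; ring
  have htm : t ∈ ratPadicSubring p := by
    obtain ⟨z, hz, h⟩ := ratCongr_iff.1 hcongr
    have : t = z := mul_left_cancel₀ hp0 (by linear_combination h - hat)
    rwa [this]
  have ham : a ∈ ratPadicSubring p := ha
  have h2am : 2 * a + 1 ∈ ratPadicSubring p := add_mem (mul_mem (ofNat_mem _ 2) ham) (one_mem _)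
  have h2tm : 2 * t + 1 ∈ ratPadicSubring p := add_mem (mul_mem (ofNat_mem _ 2) htm) (one_mem _)
  have h2tm' : 2 * t + 2 ∈ ratPadicSubring p :=
    add_mem (mul_mem (ofNat_mem _ 2) htm) (ofNat_mem _ 2)
  rw [show (p - 1) / 2 = n by omega]
  refine ⟨fun hlt => ?_, fun hgt htn => ?_, fun hgt htn => ?_⟩
  · refine chooseSum_congr_of_lt_half hn htm ?_ hat
    rw [lt_div_iff₀ two_pos] at hlt
    have : r * 2 < p := by exact_mod_cast hlt
    omega
  all_goals
    obtain ⟨r', hr'⟩ : ∃ r', r + r' = 2 * n := ⟨2 * n - r, by omega⟩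
    -- Strictness makes 2r'+1 < p, hence invertible.
    have hrn : r' < n := by
      rw [div_lt_iff₀ two_pos] at hgt
      have : p < r * 2 := by exact_mod_cast hgt
      omega
    have hq : (r : ℚ) + r' = 2 * n := by exact_mod_cast hr'
    have hS := chooseSum_congr_of_half_lt hn htm hr' hrn.le hat
    have hXm : altHarmonic (p - 1) - 2 * altHarmonic (2 * r') ∈ ratPadicSubring p :=
      sub_mem (altHarmonic_mem (by omega)) (mul_mem (ofNat_mem _ 2) (altHarmonic_mem (by omega)))
    have hi : (((2 * r' + 1 : ℕ)) : ℚ)⁻¹ ∈ ratPadicSubring p :=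
      inv_natCast_mem (by omega) (by omega)
    have hA : altHarmonic (2 * r' + 1) = altHarmonic (2 * r') - ((2 * r' + 1 : ℕ) : ℚ)⁻¹ := by
      rw [altHarmonic_succ, Odd.neg_one_pow ⟨r', rfl⟩]
      push_cast
      ring
    -- This is 2a+1 = -(2r'+1) + p(2t+2) divided by 2r'+1.
    have hi1 : (2 * a + 1) * ((2 * r' + 1 : ℕ) : ℚ)⁻¹
        = -1 + p * (2 * t + 2) * ((2 * r' + 1 : ℕ) : ℚ)⁻¹ := by
      have h0 : ((2 * r' + 1 : ℕ) : ℚ) ≠ 0 := by positivity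
      field_simp
      push_cast
      linear_combination 2 * hat + 2 * hq - 2 * hpn
    generalize ((2 * r' + 1 : ℕ) : ℚ)⁻¹ = i at hi hA hi1
    obtain ⟨z, hz, hS⟩ := ratCongr_iff.1 hS
    generalize hX : altHarmonic (p - 1) - 2 * altHarmonic (2 * r') = X at hXm hS
  -- Here s = 2r-p is odd and is the residue of 2a.
  · obtain ⟨s, hs⟩ : ∃ s, s + (2 * r' + 1) = p - 1 := ⟨p - 1 - (2 * r' + 1), by omega⟩
    have hsq : (s : ℚ) + (2 * r' + 1) + 1 = p := by
      rw [← Nat.sub_add_cancel hp.one_le, ← hs]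
      push_cast
      ring
    have hR := altHarmonic_reflect (p := p) (by omega) (show s < p by omega)
    rw [show p - 1 - s = 2 * r' + 1 by omega, hA] at hR
    obtain ⟨w, hw, hR⟩ := ratCongr_iff.1 hR
    have hU := sum_choose_neg_two_pow_congr (p := p) (by omega) h2tm (show s < p by omega)
    rw [Odd.neg_one_pow (by rw [Nat.odd_iff]; omega),
      show (s : ℚ) + p * (2 * t + 1) = 2 * a by
        linear_combination hsq - 2 * hat - 2 * hq + 2 * hpn] at hU
    obtain ⟨v, hv, hU⟩ := ratCongr_iff.1 hU
    have hu0 : 2 * t + 1 ≠ 0 := by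
      intro h
      exact htn (ratCongr_iff.2 ⟨0, zero_mem _, by linear_combination h / 2⟩)
    have hu : (2 * t + 1)⁻¹ ∈ ratPadicSubring p := by
      refine inv_mem_of_not_ratCongr h2tm fun h => htn ?_
      obtain ⟨y, hy, h⟩ := ratCongr_iff.1 h
      exact ratCongr_iff.2 ⟨2⁻¹ * y, mul_mem (two_inv_mem (by omega)) hy,
        by linear_combination h / 2⟩
    refine ratCongr_iff.2 ⟨z + (2 * a + 1) * (1 + (2 * t + 1)⁻¹) * (v - 2 * ((2 * t + 1) * w))
      - 2 * ((2 * t + 2) ^ 2 * i), sub_mem (add_mem hz (mul_mem (mul_mem h2am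
        (add_mem (one_mem _) hu)) (sub_mem hv (mul_mem (ofNat_mem _ 2) (mul_mem h2tm hw)))))
          (mul_mem (ofNat_mem _ 2) (mul_mem (pow_mem h2tm' 2) hi)), ?_⟩
    rw [hU, hR]
    refine hS.trans ?_
    have hui := mul_inv_cancel₀ hu0
    rw [div_eq_mul_inv, div_eq_mul_inv, ← hX]
    -- Passing from A_{2r'} to A_{2r'+1} contributes -4p(t+1) mod p², which accounts for the
    -- opposite signs of 2p(t+1) in the two formulas.
    linear_combination (-2 * p * (2 * t + 2)) * hi1 - (2 * a + 1) * p *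
      (altHarmonic (p - 1) - 2 * altHarmonic (2 * r') + 2 * i) * hui
  -- Mod p, -2a ≡ 2r'+2, one more than the odd number 2r'+1.
  · have hx : RatCongr p 1 (-2 * a) (((2 * r' + 1 : ℕ) : ℚ) + 1) := by
      refine ratCongr_iff.2 ⟨-(2 * t + 2), neg_mem h2tm', ?_⟩
      push_cast
      linear_combination -2 * hat - 2 * hq + 2 * hpn
    have hE := (eulerPoly_congr (by omega) (p - 2) (mul_mem (neg_mem (ofNat_mem _ 2)) ham)
      (add_mem (natCast_mem _ _) (one_mem _)) hx).trans
      (eulerPoly_odd_add_one_congr (by omega) (show 2 * r' + 1 < p by omega) ⟨r', rfl⟩)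
    obtain ⟨e, he, hE⟩ := ratCongr_iff.1 hE
    obtain ⟨w, hw, htw⟩ := ratCongr_iff.1 htn
    refine ratCongr_iff.2 ⟨z - 2 * w + 2 * (2 * a + 1) * (w * X) - 2 * (2 * t + 2) * i
      - (2 * a + 1) * e, sub_mem (sub_mem (add_mem (sub_mem hz (mul_mem (ofNat_mem _ 2) hw))
        (mul_mem (mul_mem (ofNat_mem _ 2) h2am) (mul_mem hw hXm)))
          (mul_mem (mul_mem (ofNat_mem _ 2) h2tm') hi)) (mul_mem h2am he), ?_⟩
    rw [hE, hA]
    refine hS.trans ?_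
    rw [← hX]
    -- Since t ≡ -1/2, the factor 2(t+1) becomes 1 mod p.
    linear_combination (-2 * p) * hi1 + (-2 * p + (2 * a + 1) * 2 * p *
      (altHarmonic (p - 1) - 2 * altHarmonic (2 * r'))) * htw
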